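/- \textbf{Setting.} Let $N\ge 1$ offline nodes be partitioned into classes $c\in[C]$, and let $b_c$ be the proportion of offline nodes of class $c$. Everything below is conditional on the classes of the offline nodes and holds for every assignment of these classes. Let $\alpha>0$ be such that $T=\alpha N$ is an integer. Online nodes $1,\dots,T$ arrive one after the other; their classes $d_1,\dots,d_T\in[D]$ are independent with law $\nu$. Given the classes, an edge between an offline node of class $c$ and an online node of class $d$ is present with probability $p(c,d)=a_{c,d}/N$, independently of all other edges, where $0\le a_{c,d}\le a$ for all $c,d$ and $a\in(0,N)$ is a constant. Let $Q^*$ be an optimal transport plan between $\nu$ and $b$: a maximizer of $\sum_{c,d}Q(c,d)\,p(c,d)$ over all $Q\ge 0$ with $\sum_d Q(c,d)=b_c$ for all $c$ and $\sum_c Q(c,d)=\nu(d)$ for all $d$. The Myopic policy starts with the empty matching. When online node $t$ arrives, it draws a class $c_t$, equal to $c$ with probability $Q^*(c,d_t)/\nu(d_t)$, without regard to the edges or the past. If $t$ has neighbours of class $c_t$ that are still unmatched, it is matched to one of them, chosen uniformly at random; otherwise it stays unmatched. Let $M_c(t)$ be the number of offline nodes of class $c$ that are matched after the first $t$ arrivals.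 Put $$L_c=\sum_{d=1}^D a_{c,d}\,Q^*(c,d),\qquad J_c=\frac{b_c^2}{2}\sum_{d=1}^D a_{c,d}^2\,Q^*(c,d).$$ \textbf{Theorem (Myopic fluid limit).} For every class $c\in[C]$ the problem $$\dot y_c(s)=\sum_{d=1}^D\bigl(1-e^{-a_{c,d}(b_c-y_c(s))}\bigr)Q^*(c,d)\quad(0\le s\le\alpha),\qquad y_c(0)=0,$$ has a unique solution $y_c:[0,\alpha]\to\mathbb R$. With probability at least $1-2C\exp\bigl(-N^{1/3}L_c^2/(8\alpha)\bigr)$, $$\left|\frac{M_c(t)}{N}-y_c\!\left(\frac tN\right)\right|\le\frac{3L_ce^{\alpha L_c}}{N^{1/3}}\qquad\text{for all } t\in\{0,1,\dots,T\}.$$ Moreover, for all $s\in[0,\alpha]$, $y_c(s)=b_c-b_ce^{-L_cs}-e_c(s)$, where $e_c(0)=0$ and $$0\le e_c(s)\le\frac{J_c}{L_c}\bigl(1-e^{-L_cs}\bigr)$$ (if $L_c=0$, then $J_c=0$ and the right-hand side is read as $0$). -/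

import Mathlib

open scoped BigOperators ENNReal

noncomputable section

namespace Myopic

/-- The law of a family of independent random variables `x i`, where `x i` has law `q i`. -/
def productLaw {ι β : Type*} [Fintype ι] [DecidableEq ι] [Fintype β] (q : ι → PMF β) :
    PMF (ι → β) :=
  PMF.ofFintype (fun x => ∏ i, q i (x i)) (by
    rw [← Fintype.prod_sum]
    refine Finset.prod_eq_one fun i _ => ?_
    rw [← tsum_fintype (L := .unconditional β)]
    exact (q i).tsum_coe)

/-- A coin which shows `true` with probability `p` and `false` with probability `1 - p`. -/
def coin (p : ℝ) (h0 : 0 ≤ p) (h1 : p ≤ 1) : PMF Bool :=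
  PMF.ofFintype (fun b => if b then ENNReal.ofReal p else ENNReal.ofReal (1 - p)) (by
    rw [Fintype.sum_bool]
    simp only [if_true, Bool.false_eq_true, if_false]
    rw [← ENNReal.ofReal_add h0 (sub_nonneg.2 h1), add_sub_cancel, ENNReal.ofReal_one])

/-- The sparse bipartite stochastic block model with `N` offline nodes, `C` offline classes and
`D` online classes, given the classes of the offline nodes. -/
structure BlockModel (N C D : ℕ) where
  /-- the class of every offline node -/
  cls : Fin N → Fin C
  /-- the law of the class of an online node -/
  ν : PMF (Fin D)
  /-- the affinities; the edge probabilities are `a c d / N` -/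
  a : Fin C → Fin D → ℝ
  a_nonneg : ∀ c d, 0 ≤ a c d
  a_lt : ∀ c d, a c d < N

namespace BlockModel

variable {N C D : ℕ} (S : BlockModel N C D)

/-- The probability of an edge between nodes of classes `c` and `d`. -/
def p (c : Fin C) (d : Fin D) : ℝ := S.a c d / N

theorem p_nonneg (c : Fin C) (d : Fin D) : 0 ≤ S.p c d :=
  div_nonneg (S.a_nonneg c d) (Nat.cast_nonneg N)

theorem p_le_one (c : Fin C) (d : Fin D) : S.p c d ≤ 1 :=
  div_le_one_of_le₀ (S.a_lt c d).le (Nat.cast_nonneg N)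

/-- The proportion of offline nodes of class `c`. -/
def b (c : Fin C) : ℝ := ((Finset.univ.filter fun n => S.cls n = c).card : ℝ) / N

/-- `Q` is a transport plan (coupling) between `ν` and `b`. -/
structure IsPlan (Q : Fin C → Fin D → ℝ) : Prop where
  nonneg : ∀ c d, 0 ≤ Q c d
  sum_right : ∀ c, ∑ d, Q c d = S.b c
  sum_left : ∀ d, ∑ c, Q c d = (S.ν d).toReal

/-- `Q` is a transport plan which maximises `∑ c, ∑ d, Q c d * p c d`. -/
def IsOptimalPlan (Q : Fin C → Fin D → ℝ) : Prop :=
  S.IsPlan Q ∧ ∀ R, S.IsPlan R → ∑ c, ∑ d, R c d * S.p c d ≤ ∑ c, ∑ d, Q c d * S.p c d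

/-- The online side of the random graph with `T` online nodes: the classes of the online nodes,
and the set of edges as its indicator. -/
abbrev Graph (N D T : ℕ) : Type := (Fin T → Fin D) × (Fin N × Fin T → Bool)

/-- The law of the random graph: the classes of the online nodes are independent with law `ν`
and, given the classes, the edges `(n, t)` are present independently of each other, with
probability `p (c(n)) (d(t))`. -/
def graphLaw (T : ℕ) : PMF (Graph N D T) :=
  (productLaw fun _ : Fin T => S.ν).bind fun d =>
    (productLaw fun e : Fin N × Fin T =>
      coin (S.p (S.cls e.1) (d e.2)) (S.p_nonneg _ _) (S.p_le_one _ _)).map fun E => (d, E)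

/-- The law of the class chosen by the policy when an online node of class `d` arrives:
class `c` has probability `Q c d / ν d`. If `Q` is a transport plan then these numbers are a
probability vector whenever `ν d ≠ 0`; nodes of a class `d` with `ν d = 0` almost surely never
arrive, and the value for such a class has no importance. -/
def choiceLaw [NeZero C] (Q : Fin C → Fin D → ℝ) (d : Fin D) : PMF (Fin C) :=
  open Classical in
  if h : ∑ c, ENNReal.ofReal (Q c d / (S.ν d).toReal) = 1 then PMF.ofFintype _ h
  else PMF.pure 0

/-- A set of pairs (offline node, online node). -/
abbrev Matching (N T : ℕ) : Type := Finset (Fin N × Fin T)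

/-- The neighbours of the online node `t` which have class `c` and are still unmatched. -/
def available {T : ℕ} (G : Graph N D T) (t : Fin T) (A : Matching N T) (c : Fin C) :
    Finset (Fin N) :=
  Finset.univ.filter fun n => S.cls n = c ∧ G.2 (n, t) = true ∧ ∀ s, (n, s) ∉ A

/-- The arrival of the online node `t` when the current matching is `A`: a class is chosen, and
`t` is matched to a uniformly random available neighbour of this class if there is one. -/
def step [NeZero C] (Q : Fin C → Fin D → ℝ) {T : ℕ} (G : Graph N D T) (t : Fin T)
    (A : Matching N T) : PMF (Matching N T) :=
  (S.choiceLaw Q (G.1 t)).bind fun c =>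
    open Classical in
    if h : (S.available G t A c).Nonempty then
      (PMF.uniformOfFinset (S.available G t A c) h).map fun n => insert (n, t) A
    else PMF.pure A

/-- The law of the sequence of matchings built by the policy on the graph `G` in its first `k`
steps: the value of the sequence at `t` is the matching after the first `t` arrivals (for
`t ≤ k`; the other values are empty sets). -/
def run [NeZero C] (Q : Fin C → Fin D → ℝ) {T : ℕ} (G : Graph N D T) :
    ℕ → PMF (ℕ → Matching N T)
  | 0 => PMF.pure fun _ => ∅
  | k + 1 => (run Q G k).bind fun m =>
      if h : k < T then
        (S.step Q G ⟨k, h⟩ (m k)).map fun A => Function.update m (k + 1) A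
      else PMF.pure m

/-- The law of the sequence of matchings built by the policy on the random graph. -/
def myopicLaw [NeZero C] (Q : Fin C → Fin D → ℝ) (T : ℕ) : PMF (ℕ → Matching N T) :=
  (S.graphLaw T).bind fun G => S.run Q G T

/-- The number of matched offline nodes of class `c` in the matching `A`. -/
def matchedCount {T : ℕ} (c : Fin C) (A : Matching N T) : ℕ :=
  (Finset.univ.filter fun n => S.cls n = c ∧ ∃ t, (n, t) ∈ A).card

/-- `y` solves `y' = ∑ d, (1 - exp (-a c d * (b c - y))) * Q c d` on `[0, α]`, `y 0 = 0`. -/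
def IsFluidSolution (Q : Fin C → Fin D → ℝ) (α : ℝ) (c : Fin C) (y : ℝ → ℝ) : Prop :=
  y 0 = 0 ∧ ∀ s ∈ Set.Icc 0 α, HasDerivWithinAt y
    (∑ d, (1 - Real.exp (-S.a c d * (S.b c - y s))) * Q c d) (Set.Icc 0 α) s

/-- The constant `L_c`. -/
def L (Q : Fin C → Fin D → ℝ) (c : Fin C) : ℝ := ∑ d, S.a c d * Q c d

/-- The constant `J_c`. -/
def J (Q : Fin C → Fin D → ℝ) (c : Fin C) : ℝ := S.b c ^ 2 / 2 * ∑ d, S.a c d ^ 2 * Q c d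

end BlockModel

end Myopic

end

/-! The policy looks at the edges of an online node only when that node arrives, so each arrival may
be resampled independently of the past (`avg_myopicLaw_le`). The edges from the arriving node to the
`u` unmatched nodes of class `c` are then fresh, and one is present with probability `1 - (1 - p c
d) ^ u`. Hence the number of matched nodes of class `c` is a Markov chain that jumps by one with
probability `rate` (`IsPlan.avg_arrival`).

The count minus the sum of its rates is a martingale with increments bounded by 1. A stopped
exponential supermartingale gives a maximal inequality for it (`IsPlan.avg_fluctuation_le`). On the
event that this martingale stays small, the rest is deterministic: `rate` is within `L / N` of
`drift`, the chain is a perturbed Euler scheme of step `1 / N` for the fluid equation, and discrete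
Gronwall bounds the error (`IsPlan.abs_matchedCount_sub_solution_le`). `IsPlan.concentration`
chooses the fluctuation level.

For the fluid equation, `drift` lies between `L (b - y) - J` and `L (b - y)` when `0 ≤ y ≤ b`.
Integrating these linear inequalities with the factor `exp (L s)` gives the explicit approximation.
Existence follows from Picard–Lindelöf for the drift truncated at `b`. -/

namespace Myopic

/-! ### Averages under discrete laws -/

/-- The expectation of an extended nonnegative function under a discrete law. -/
noncomputable def avg {β : Type*} (p : PMF β) (f : β → ℝ≥0∞) : ℝ≥0∞ := ∑' x, p x * f x

section avg

variable {β γ : Type*}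

theorem avg_pure (x : β) (f : β → ℝ≥0∞) : avg (PMF.pure x) f = f x := by
  classical
  unfold avg
  rw [tsum_eq_single x]
  · simp
  · intro y hy
    simp [PMF.pure_apply, hy]

theorem avg_bind (p : PMF β) (q : β → PMF γ) (f : γ → ℝ≥0∞) :
    avg (p.bind q) f = avg p fun x => avg (q x) f := by
  unfold avg
  simp only [PMF.bind_apply, ← ENNReal.tsum_mul_right, ← ENNReal.tsum_mul_left]
  rw [ENNReal.tsum_comm]
  simp only [mul_assoc]

theorem avg_map (p : PMF β) (g : β → γ) (f : γ → ℝ≥0∞) :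
    avg (p.map g) f = avg p fun x => f (g x) := by
  rw [← PMF.bind_pure_comp, avg_bind]
  simp only [Function.comp, avg_pure]

theorem avg_mono_on (p : PMF β) {f g : β → ℝ≥0∞} (h : ∀ x ∈ p.support, f x ≤ g x) :
    avg p f ≤ avg p g := by
  refine ENNReal.tsum_le_tsum fun x => ?_
  by_cases hx : p x = 0
  · simp [hx]
  · exact mul_le_mul_right (h x ((p.mem_support_iff x).2 hx)) _

theorem avg_mono (p : PMF β) {f g : β → ℝ≥0∞} (h : ∀ x, f x ≤ g x) : avg p f ≤ avg p g :=
  avg_mono_on p fun x _ => h x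

theorem avg_congr_on (p : PMF β) {f g : β → ℝ≥0∞} (h : ∀ x ∈ p.support, f x = g x) :
    avg p f = avg p g :=
  le_antisymm (avg_mono_on p fun x hx => (h x hx).le) (avg_mono_on p fun x hx => (h x hx).ge)

theorem avg_const (p : PMF β) (a : ℝ≥0∞) : avg p (fun _ => a) = a := by
  rw [avg, ENNReal.tsum_mul_right, p.tsum_coe, one_mul]

theorem avg_add (p : PMF β) (f g : β → ℝ≥0∞) :
    avg p (fun x => f x + g x) = avg p f + avg p g := by
  simp only [avg, mul_add, ENNReal.tsum_add]

theorem avg_mul_const (p : PMF β) (f : β → ℝ≥0∞) (a : ℝ≥0∞) :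
    avg p (fun x => f x * a) = avg p f * a := by
  simp only [avg, ← mul_assoc, ENNReal.tsum_mul_right]

theorem avg_const_mul (p : PMF β) (f : β → ℝ≥0∞) (a : ℝ≥0∞) :
    avg p (fun x => a * f x) = a * avg p f := by
  simp only [mul_comm a, avg_mul_const]

theorem avg_comm (p : PMF β) (q : PMF γ) (f : β → γ → ℝ≥0∞) :
    (avg p fun x => avg q fun y => f x y) = avg q fun y => avg p fun x => f x y := by
  simp only [avg, ← ENNReal.tsum_mul_left]
  rw [ENNReal.tsum_comm]
  simp only [mul_left_comm]

theorem avg_fintype [Fintype β] (p : PMF β) (f : β → ℝ≥0∞) : avg p f = ∑ x, p x * f x :=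
  tsum_fintype _

theorem toOuterMeasure_eq_avg (p : PMF β) (s : Set β) :
    p.toOuterMeasure s = avg p (s.indicator fun _ => 1) := by
  rw [PMF.toOuterMeasure_apply, avg]
  refine tsum_congr fun x => ?_
  by_cases hx : x ∈ s <;> simp [hx]

/-- A variable with two values on the support is averaged by means of the probability of one
of them. -/
theorem avg_two_values (p : PMF β) {P : β → Prop} [DecidablePred P] {f : β → ℝ≥0∞} {u v : ℝ≥0∞}
    {r : ℝ} (hr : 0 ≤ r) (hf : ∀ x ∈ p.support, f x = if P x then u else v)
    (hP : avg p (fun x => if P x then 1 else 0) = ENNReal.ofReal r) :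
    avg p f = ENNReal.ofReal r * u + ENNReal.ofReal (1 - r) * v := by
  have h1 : avg p (fun x => if P x then 1 else 0) + avg p (fun x => if P x then 0 else 1) = 1 := by
    rw [← avg_add, ← avg_const p 1]
    refine congrArg _ (funext fun x => ?_)
    rw [avg_const]
    split_ifs <;> simp
  have h2 : avg p (fun x => if P x then 0 else 1) = ENNReal.ofReal (1 - r) := by
    rw [hP] at h1
    rw [ENNReal.ofReal_sub _ hr, ENNReal.ofReal_one]
    exact ENNReal.eq_sub_of_add_eq ENNReal.ofReal_ne_top (by rw [add_comm]; exact h1)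
  rw [← hP, ← h2, ← avg_mul_const, ← avg_mul_const, ← avg_add, avg_congr_on p hf]
  refine congrArg _ (funext fun x => ?_)
  split_ifs <;> simp

end avg

/-! ### Independent families and resampling -/

section productLaw

variable {ι β : Type*} [Fintype ι] [DecidableEq ι] [Fintype β]

theorem productLaw_apply (q : ι → PMF β) (x : ι → β) : productLaw q x = ∏ i, q i (x i) := rfl

theorem avg_productLaw_prod (q : ι → PMF β) (g : ι → β → ℝ≥0∞) :
    avg (productLaw q) (fun x => ∏ i, g i (x i)) = ∏ i, avg (q i) (g i) := by
  simp only [avg_fintype, Fintype.prod_sum, productLaw_apply, Finset.prod_mul_distrib]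

/-- Replacing a coordinate of an independent family by an independent copy does not change the
law of the family. -/
theorem avg_productLaw_resample (q : ι → PMF β) (i : ι) (f : (ι → β) → ℝ≥0∞) :
    avg (productLaw q) f =
      avg (productLaw q) fun x => avg (q i) fun v => f (Function.update x i v) := by
  -- Exchanging coordinate `i` with the fresh copy is an involution that preserves the joint weight
  -- (`hw`).
  let σ : (ι → β) × β → (ι → β) × β := fun z => (Function.update z.1 i z.2, z.1 i)
  have hσ : Function.Involutive σ := fun z => by simp [σ]
  have hw : ∀ z : (ι → β) × β, productLaw q (Function.update z.1 i z.2) * q i (z.1 i) =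
      productLaw q z.1 * q i z.2 := fun z => by
    rw [productLaw_apply, productLaw_apply, ← Finset.mul_prod_erase _ _ (Finset.mem_univ i),
      ← Finset.mul_prod_erase _ (fun j => q j (z.1 j)) (Finset.mem_univ i),
      Finset.prod_congr rfl (g := fun j => q j (z.1 j))]
    · rw [Function.update_self]; ring
    · intro j hj
      rw [Function.update_of_ne (Finset.ne_of_mem_erase hj)]
  calc avg (productLaw q) f
      = avg (productLaw q) fun x => avg (q i) fun _ => f x := by simp only [avg_const]
    _ = ∑ z : (ι → β) × β, productLaw q z.1 * q i z.2 * f z.1 := by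
        simp only [avg_fintype, Fintype.sum_prod_type, Finset.mul_sum, mul_assoc]
    _ = ∑ z : (ι → β) × β, productLaw q z.1 * q i z.2 * f (Function.update z.1 i z.2) := by
        rw [← Equiv.sum_comp hσ.toPerm]
        exact Finset.sum_congr rfl fun z _ => congrArg (· * _) (hw z)
    _ = _ := by simp only [avg_fintype, Fintype.sum_prod_type, Finset.mul_sum, mul_assoc]

end productLaw

theorem avg_coin (p : ℝ) (h0 : 0 ≤ p) (h1 : p ≤ 1) (f : Bool → ℝ≥0∞) :
    avg (coin p h0 h1) f = ENNReal.ofReal p * f true + ENNReal.ofReal (1 - p) * f false := by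
  rw [avg_fintype, Fintype.sum_bool]
  rfl

theorem avg_uniformOfFinset_const {β : Type*} (s : Finset β) (h : s.Nonempty) {f : β → ℝ≥0∞}
    {a : ℝ≥0∞} (hf : ∀ x ∈ s, f x = a) : avg (PMF.uniformOfFinset s h) f = a := by
  rw [avg_congr_on (g := fun _ => a), avg_const]
  intro x hx
  exact hf x ((PMF.mem_support_uniformOfFinset_iff h x).1 hx)

/-! ### The matched count as a Markov chain -/

namespace BlockModel

variable {N C D : ℕ} (S : BlockModel N C D)

/-- An online node: its class and the indicator of its neighbours. -/
abbrev Arrival (N D : ℕ) : Type := Fin D × (Fin N → Bool)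

/-- The law of the class and the neighbours of an online node. -/
noncomputable def arrivalLaw : PMF (Arrival N D) :=
  S.ν.bind fun d => (productLaw fun n : Fin N =>
    coin (S.p (S.cls n) d) (S.p_nonneg _ _) (S.p_le_one _ _)).map fun E => (d, E)

/-- The graph with the given online nodes. -/
def toGraph {T : ℕ} (x : Fin T → Arrival N D) : Graph N D T :=
  (fun t => (x t).1, fun e => (x e.2).2 e.1)

theorem arrivalLaw_apply (v : Arrival N D) :
    S.arrivalLaw v = S.ν v.1 * productLaw (fun n : Fin N =>
      coin (S.p (S.cls n) v.1) (S.p_nonneg _ _) (S.p_le_one _ _)) v.2 := by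
  obtain ⟨d, E⟩ := v
  rw [arrivalLaw, PMF.bind_apply, tsum_eq_single d]
  · congr 1
    rw [PMF.map_apply, tsum_eq_single E]
    · simp
    · intro E' hE
      simp [hE.symm]
  · intro d' hd
    simp [hd.symm]

/-- The online nodes, with their edges, are independent and identically distributed. -/
theorem avg_graphLaw {T : ℕ} (f : Graph N D T → ℝ≥0∞) :
    avg (S.graphLaw T) f =
      avg (productLaw fun _ : Fin T => S.arrivalLaw) fun x => f (toGraph x) := by
  let e : (Fin T → Arrival N D) ≃ Graph N D T :=
    { toFun := toGraph
      invFun := fun G t => (G.1 t, fun n => G.2 (n, t))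
      left_inv := fun x => rfl
      right_inv := fun G => rfl }
  rw [graphLaw, avg_bind]
  simp only [avg_map]
  simp only [avg_fintype, Finset.mul_sum]
  rw [← Fintype.sum_prod_type' (f := fun d E => productLaw (fun _ => S.ν) d *
    (productLaw (fun e : Fin N × Fin T =>
      coin (S.p (S.cls e.1) (d e.2)) (S.p_nonneg _ _) (S.p_le_one _ _)) E * f (d, E))),
    ← Equiv.sum_comp e]
  refine Finset.sum_congr rfl fun x _ => ?_
  rw [← mul_assoc]
  congr 1
  simp only [productLaw_apply, arrivalLaw_apply, Fintype.prod_prod_type_right,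
    Finset.prod_mul_distrib]
  rfl

section policy

variable (Q : Fin C → Fin D → ℝ) {T : ℕ}

theorem available_congr {G G' : Graph N D T} {t : Fin T} (h : ∀ n, G.2 (n, t) = G'.2 (n, t))
    (A : Matching N T) (c : Fin C) : S.available G t A c = S.available G' t A c := by
  simp only [available, h]

theorem step_congr [NeZero C] {G G' : Graph N D T} {t : Fin T} (h1 : G.1 t = G'.1 t)
    (h2 : ∀ n, G.2 (n, t) = G'.2 (n, t)) (A : Matching N T) :
    S.step Q G t A = S.step Q G' t A := by
  simp only [step, h1, S.available_congr h2]

/-- This is the nonanticipation of the policy: the first `k` steps see only the first `k` online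
nodes, so the node with index `k` can be resampled without affecting them. -/
theorem run_congr [NeZero C] {G G' : Graph N D T} {k : ℕ}
    (h : ∀ t : Fin T, (t : ℕ) < k → G.1 t = G'.1 t ∧ ∀ n, G.2 (n, t) = G'.2 (n, t)) :
    S.run Q G k = S.run Q G' k := by
  induction k with
  | zero => rfl
  | succ k ih =>
    rw [run, run, ih fun t ht => h t (by omega)]
    congr 1
    funext m
    split_ifs with hk
    · rw [S.step_congr Q (h ⟨k, hk⟩ (Nat.lt_succ_self k)).1 (h ⟨k, hk⟩ (Nat.lt_succ_self k)).2]
    · rfl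

/-- A function of the sequence of matchings which decreases on average at every arrival, the
arriving online node being averaged as well, decreases on average along the run. -/
theorem avg_myopicLaw_le [NeZero C] (f : ℕ → (ℕ → Matching N T) → ℝ≥0∞)
    (hf : ∀ (k : Fin T) (m : ℕ → Matching N T) (x : Fin T → Arrival N D),
      (avg S.arrivalLaw fun v => avg (S.step Q (toGraph (Function.update x k v)) k (m k)) fun A =>
        f (k + 1) (Function.update m (k + 1) A)) ≤ f k m) :
    avg (S.myopicLaw Q T) (f T) ≤ f 0 fun _ => ∅ := by
  have key : ∀ k ≤ T, (avg (productLaw fun _ : Fin T => S.arrivalLaw) fun x =>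
      avg (S.run Q (toGraph x) k) (f k)) ≤ f 0 fun _ => ∅ := by
    intro k
    induction k with
    | zero =>
      intro _
      simp only [run, avg_pure, avg_const, le_refl]
    | succ k ih =>
      intro hk
      refine le_trans ?_ (ih (by omega))
      -- Deferred decision: node `k` becomes a fresh copy, the run up to time `k` ignores it
      -- (`hrun`), and `avg_comm` allows it to be averaged last, with the past fixed.
      rw [avg_productLaw_resample _ ⟨k, hk⟩]
      refine avg_mono _ fun x => ?_
      have hrun : ∀ v, S.run Q (toGraph (Function.update x ⟨k, hk⟩ v)) k =
          S.run Q (toGraph x) k := fun v => by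
        refine S.run_congr Q fun t ht => ?_
        have : t ≠ ⟨k, hk⟩ := fun h => by simp [h] at ht
        simp [toGraph, Function.update_of_ne this]
      have hk' : k < T := hk
      simp only [run, avg_bind, hrun, hk', dif_pos, avg_map]
      rw [avg_comm]
      exact avg_mono _ fun m => hf ⟨k, hk⟩ m x
  rw [myopicLaw, avg_bind, avg_graphLaw]
  exact key T le_rfl

/-- The number of offline nodes of class `c`. -/
def classSize (c : Fin C) : ℕ := (Finset.univ.filter fun n => S.cls n = c).card

theorem matchedCount_le (c : Fin C) (A : Matching N T) : S.matchedCount c A ≤ S.classSize c :=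
  Finset.card_le_card fun n hn => by
    simp only [Finset.mem_filter] at hn ⊢
    exact ⟨hn.1, hn.2.1⟩

theorem matchedCount_insert_of_available {G : Graph N D T} {t : Fin T} {A : Matching N T}
    {c c' : Fin C} {n : Fin N} (hn : n ∈ S.available G t A c') :
    S.matchedCount c (insert (n, t) A) = S.matchedCount c A + if c' = c then 1 else 0 := by
  simp only [available, Finset.mem_filter, Finset.mem_univ, true_and] at hn
  obtain ⟨rfl, -, hA⟩ := hn
  split_ifs with h
  · rw [matchedCount, matchedCount, ← Finset.card_insert_of_notMem (a := n)]
    · congr 1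
      ext n'
      simp only [Finset.mem_filter, Finset.mem_univ, true_and, Finset.mem_insert, Prod.mk.injEq]
      constructor
      · rintro ⟨h1, s, ⟨rfl, rfl⟩ | h2⟩
        · exact Or.inl rfl
        · exact Or.inr ⟨h1, s, h2⟩
      · rintro (rfl | ⟨h1, s, h2⟩)
        · exact ⟨h, t, Or.inl ⟨rfl, rfl⟩⟩
        · exact ⟨h1, s, Or.inr h2⟩
    · simp [hA]
  · rw [matchedCount, matchedCount, add_zero]
    congr 1
    ext n'
    simp only [Finset.mem_filter, Finset.mem_univ, true_and, Finset.mem_insert, Prod.mk.injEq]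
    constructor
    · rintro ⟨h1, s, ⟨rfl, rfl⟩ | h2⟩
      · exact absurd h1 h
      · exact ⟨h1, s, h2⟩
    · rintro ⟨h1, s, h2⟩
      exact ⟨h1, s, Or.inr h2⟩

/-- The average of a function of the number of matched nodes of class `c` after one arrival. -/
theorem avg_step [NeZero C] (G : Graph N D T) (t : Fin T) (A : Matching N T) (c : Fin C)
    (φ : ℕ → ℝ≥0∞) :
    avg (S.step Q G t A) (fun A' => φ (S.matchedCount c A')) =
      avg (S.choiceLaw Q (G.1 t)) fun c' =>
        if c' = c ∧ (S.available G t A c).Nonempty then φ (S.matchedCount c A + 1)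
        else φ (S.matchedCount c A) := by
  classical
  rw [step, avg_bind]
  refine congrArg _ (funext fun c' => ?_)
  by_cases h : (S.available G t A c').Nonempty
  · rw [dif_pos h, avg_map]
    refine avg_uniformOfFinset_const _ h fun n hn => ?_
    rw [S.matchedCount_insert_of_available hn]
    by_cases hc : c' = c
    · subst hc
      simp [h]
    · simp [hc]
  · rw [dif_neg h, avg_pure, if_neg]
    rintro ⟨rfl, h'⟩
    exact h h'

theorem avg_choiceLaw_eq [NeZero C] {d : Fin D} {c : Fin C} (u : ℝ≥0∞) :
    avg (S.choiceLaw Q d) (fun c' => if c' = c then u else 0) = S.choiceLaw Q d c * u := by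
  rw [avg_fintype]
  simp

variable {Q}

/-- The probability that a node of class `d` arrives and class `c` is chosen. -/
theorem IsPlan.ν_mul_choiceLaw [NeZero C] (hQ : S.IsPlan Q) (c : Fin C) (d : Fin D) :
    S.ν d * S.choiceLaw Q d c = ENNReal.ofReal (Q c d) := by
  -- If `ν d = 0`, the default value of `choiceLaw` does not matter: column `d` of `Q` is
  -- nonnegative with sum zero, so both sides vanish.
  by_cases hd : S.ν d = 0
  · have h0 : ∑ c, Q c d = 0 := by rw [hQ.sum_left, hd]; rfl
    rw [hd, zero_mul, (Finset.sum_eq_zero_iff_of_nonneg fun c _ => hQ.nonneg c d).1 h0 c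
      (Finset.mem_univ c), ENNReal.ofReal_zero]
  · have hpos : 0 < (S.ν d).toReal := ENNReal.toReal_pos hd (PMF.apply_ne_top _ _)
    have h1 : ∑ c, ENNReal.ofReal (Q c d / (S.ν d).toReal) = 1 := by
      rw [← ENNReal.ofReal_sum_of_nonneg fun c _ => div_nonneg (hQ.nonneg c d) hpos.le,
        ← Finset.sum_div, hQ.sum_left, div_self hpos.ne', ENNReal.ofReal_one]
    rw [choiceLaw, dif_pos h1, PMF.ofFintype_apply]
    nth_rw 1 [← ENNReal.ofReal_toReal (PMF.apply_ne_top S.ν d)]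
    rw [← ENNReal.ofReal_mul hpos.le, mul_div_cancel₀ _ hpos.ne']

variable (Q)

/-- The probability that an arrival increases the number of matched nodes of class `c` from
`k` to `k + 1`. -/
noncomputable def rate (c : Fin C) (k : ℕ) : ℝ :=
  ∑ d, Q c d * (1 - (1 - S.p c d) ^ (S.classSize c - k))

variable {Q}

theorem IsPlan.rate_nonneg (hQ : S.IsPlan Q) (c : Fin C) (k : ℕ) : 0 ≤ S.rate Q c k :=
  Finset.sum_nonneg fun d _ => mul_nonneg (hQ.nonneg c d)
    (sub_nonneg.2 (pow_le_one₀ (sub_nonneg.2 (S.p_le_one c d)) (sub_le_self _ (S.p_nonneg c d))))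

end policy

/-- The probability that an arriving node of class `d` has an available neighbour of class `c`. -/
theorem avg_available_nonempty {T : ℕ} (x : Fin T → Arrival N D) (t : Fin T) (A : Matching N T)
    (c : Fin C) (d : Fin D) :
    (avg (productLaw fun n : Fin N =>
        coin (S.p (S.cls n) d) (S.p_nonneg _ _) (S.p_le_one _ _)) fun E =>
      if (S.available (toGraph (Function.update x t (d, E))) t A c).Nonempty then 1 else 0) =
      ENNReal.ofReal (1 - (1 - S.p c d) ^ (S.classSize c - S.matchedCount c A)) := by
  classical
  set q := fun n : Fin N => coin (S.p (S.cls n) d) (S.p_nonneg _ _) (S.p_le_one _ _) with hq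
  set U : Finset (Fin N) := Finset.univ.filter fun n => S.cls n = c ∧ ∀ s, (n, s) ∉ A with hU
  have hcard : U.card = S.classSize c - S.matchedCount c A := by
    have : S.classSize c = S.matchedCount c A + U.card := by
      rw [classSize, matchedCount, hU, ← Finset.card_union_of_disjoint]
      · congr 1
        ext n
        simp only [Finset.mem_filter, Finset.mem_univ, true_and, Finset.mem_union]
        by_cases h : ∃ s, (n, s) ∈ A
        · simp [h]
        · simp only [h, and_false, false_or]
          push Not at h
          simp [h]
      · rw [Finset.disjoint_left]
        intro n h1 h2
        simp only [Finset.mem_filter, Finset.mem_univ, true_and] at h1 h2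
        obtain ⟨s, hs⟩ := h1.2
        exact h2.2 s hs
    omega
  -- The product is the indicator that no node of `U` is adjacent to `t`, so independence turns its
  -- average into a power; `h3` and `h4` pass to the complement.
  have h1 : (avg (productLaw q) fun E => ∏ n, if n ∈ U ∧ E n = true then 0 else 1) =
      ENNReal.ofReal ((1 - S.p c d) ^ U.card) := by
    rw [avg_productLaw_prod q fun n b => if n ∈ U ∧ b = true then 0 else 1,
      ENNReal.ofReal_pow (sub_nonneg.2 (S.p_le_one c d)), ← Finset.prod_const,
      ← Finset.prod_subset (Finset.subset_univ U)]
    · refine Finset.prod_congr rfl fun n hn => ?_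
      have hc : S.cls n = c := (Finset.mem_filter.1 hn).2.1
      rw [hq]
      dsimp only
      rw [avg_coin]
      simp [hn, hc]
    · intro n _ hn
      simp [hn, avg_const]
  have h2 : ∀ E : Fin N → Bool,
      (if (S.available (toGraph (Function.update x t (d, E))) t A c).Nonempty
        then (1 : ℝ≥0∞) else 0) = if ∃ n ∈ U, E n = true then 1 else 0 := by
    intro E
    refine if_congr ?_ rfl rfl
    simp only [Finset.Nonempty, available, hU, toGraph, Finset.mem_filter, Finset.mem_univ,
      true_and, Function.update_self]
    exact exists_congr fun n => by tauto
  have h3 : ∀ E : Fin N → Bool, (if ∃ n ∈ U, E n = true then (1 : ℝ≥0∞) else 0) +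
      ∏ n, (if n ∈ U ∧ E n = true then 0 else 1) = 1 := by
    intro E
    by_cases h : ∃ n ∈ U, E n = true
    · rw [if_pos h]
      obtain ⟨n, hn⟩ := h
      have h0 : ∏ n, (if n ∈ U ∧ E n = true then (0 : ℝ≥0∞) else 1) = 0 :=
        Finset.prod_eq_zero (Finset.mem_univ n) (if_pos hn)
      rw [h0, add_zero]
    · rw [if_neg h, Finset.prod_eq_one, zero_add]
      intro n _
      rw [if_neg]
      exact fun hn => h ⟨n, hn⟩
  simp only [h2]
  have h4 : (avg (productLaw q) fun E => (if ∃ n ∈ U, E n = true then (1 : ℝ≥0∞) else 0) +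
      ∏ n, (if n ∈ U ∧ E n = true then 0 else 1)) = 1 := by
    simp only [h3, avg_const]
  rw [avg_add, h1] at h4
  rw [← hcard, ENNReal.ofReal_sub _ (pow_nonneg (sub_nonneg.2 (S.p_le_one c d)) _),
    ENNReal.ofReal_one]
  exact ENNReal.eq_sub_of_add_eq ENNReal.ofReal_ne_top h4

/-- The number of matched nodes of class `c` is a Markov chain with transition probabilities
`rate`. -/
theorem IsPlan.avg_arrival [NeZero C] {Q : Fin C → Fin D → ℝ} (hQ : S.IsPlan Q) {T : ℕ}
    (x : Fin T → Arrival N D) (t : Fin T) (A : Matching N T) (c : Fin C) (φ : ℕ → ℝ≥0∞) :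
    (avg S.arrivalLaw fun v => avg (S.step Q (toGraph (Function.update x t v)) t A) fun A' =>
      φ (S.matchedCount c A')) =
      ENNReal.ofReal (S.rate Q c (S.matchedCount c A)) * φ (S.matchedCount c A + 1) +
        ENNReal.ofReal (1 - S.rate Q c (S.matchedCount c A)) * φ (S.matchedCount c A) := by
  classical
  have hfst : ∀ v, (toGraph (Function.update x t v)).1 t = v.1 := fun v => by simp [toGraph]
  simp only [avg_step, hfst]
  -- Arrival and class choice are merged into one law on pairs, so that `avg_two_values` applies and
  -- only the probability of a jump remains to be computed.
  have hb : ∀ ψ : Arrival N D × Fin C → ℝ≥0∞,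
      (avg S.arrivalLaw fun v => avg (S.choiceLaw Q v.1) fun c' => ψ (v, c')) =
        avg (S.arrivalLaw.bind fun v => (S.choiceLaw Q v.1).map fun c' => (v, c')) ψ := by
    simp only [avg_bind, avg_map, implies_true]
  rw [hb fun z => if z.2 = c ∧ (S.available (toGraph (Function.update x t z.1)) t A c).Nonempty
    then φ (S.matchedCount c A + 1) else φ (S.matchedCount c A)]
  refine avg_two_values _ (hQ.rate_nonneg S c _) (fun z _ => rfl) ?_
  simp only [avg_bind, avg_map]
  have h1 : ∀ v : Arrival N D, (avg (S.choiceLaw Q v.1) fun c' =>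
      if c' = c ∧ (S.available (toGraph (Function.update x t v)) t A c).Nonempty
        then (1 : ℝ≥0∞) else 0) = S.choiceLaw Q v.1 c *
      if (S.available (toGraph (Function.update x t v)) t A c).Nonempty then 1 else 0 := by
    intro v
    rw [← avg_choiceLaw_eq]
    refine congrArg _ (funext fun c' => ?_)
    by_cases h : c' = c <;> simp [h]
  simp only [h1]
  rw [arrivalLaw, avg_bind]
  simp only [avg_map, avg_const_mul, avg_available_nonempty]
  rw [avg_fintype, rate, ENNReal.ofReal_sum_of_nonneg]
  · refine Finset.sum_congr rfl fun d _ => ?_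
    rw [← mul_assoc, hQ.ν_mul_choiceLaw, ENNReal.ofReal_mul (hQ.nonneg c d)]
  · exact fun d _ => mul_nonneg (hQ.nonneg c d) (sub_nonneg.2 (pow_le_one₀
      (sub_nonneg.2 (S.p_le_one c d)) (sub_le_self _ (S.p_nonneg c d))))

end BlockModel

/-! ### The fluid equation -/

/-- A Lipschitz bound for the truncated exponential. -/
theorem abs_exp_sub_exp_le {x y : ℝ} (hx : x ≤ 0) (hy : y ≤ 0) :
    |Real.exp x - Real.exp y| ≤ |x - y| := by
  wlog h : y ≤ x generalizing x y
  · rw [abs_sub_comm, abs_sub_comm x]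
    exact this hy hx (le_of_not_ge h)
  rw [abs_of_nonneg (sub_nonneg.2 (Real.exp_le_exp.2 h)), abs_of_nonneg (sub_nonneg.2 h)]
  have h1 : Real.exp y = Real.exp x * Real.exp (-(x - y)) := by rw [← Real.exp_add]; ring_nf
  have h2 := Real.one_sub_le_exp_neg (x - y)
  have h3 : Real.exp x ≤ 1 := Real.exp_le_one_iff.2 hx
  nlinarith [Real.exp_pos x]

/-- `y' + l y ≤ g` integrated by means of the factor `exp (l s)`. -/
theorem mul_exp_le_of_deriv_le {y y' B B' : ℝ → ℝ} {α l : ℝ}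
    (hy : ∀ s ∈ Set.Icc 0 α, HasDerivWithinAt y (y' s) (Set.Icc 0 α) s)
    (hB : ∀ s, HasDerivAt B (B' s) s) (h0 : y 0 ≤ B 0)
    (h : ∀ s ∈ Set.Icc 0 α, (y' s + l * y s) * Real.exp (l * s) ≤ B' s) :
    ∀ s ∈ Set.Icc 0 α, y s * Real.exp (l * s) ≤ B s := by
  have hd : ∀ s ∈ Set.Icc 0 α, HasDerivWithinAt (fun s => y s * Real.exp (l * s))
      ((y' s + l * y s) * Real.exp (l * s)) (Set.Icc 0 α) s := by
    intro s hs
    have h1 : HasDerivAt (fun s => Real.exp (l * s)) (Real.exp (l * s) * (l * 1)) s :=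
      ((hasDerivAt_id s).const_mul l).exp
    refine ((hy s hs).mul h1.hasDerivWithinAt).congr_deriv ?_
    ring
  refine image_le_of_deriv_right_le_deriv_boundary (f' := fun s =>
    (y' s + l * y s) * Real.exp (l * s)) (fun s hs => (hd s hs).continuousWithinAt) ?_ (by simpa)
    (fun s _ => (hB s).continuousAt.continuousWithinAt) (fun s _ => (hB s).hasDerivWithinAt)
    fun s hs => h s (Set.Ico_subset_Icc_self hs)
  intro s hs
  exact (hd s (Set.Ico_subset_Icc_self hs)).mono_of_mem_nhdsWithin
    (Icc_mem_nhdsGE_of_mem hs)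

namespace BlockModel

variable {N C D : ℕ} (S : BlockModel N C D) (Q : Fin C → Fin D → ℝ)

/-- The right-hand side of the fluid equation. -/
noncomputable def drift (c : Fin C) (y : ℝ) : ℝ :=
  ∑ d, (1 - Real.exp (-S.a c d * (S.b c - y))) * Q c d

theorem b_nonneg (c : Fin C) : 0 ≤ S.b c := div_nonneg (Nat.cast_nonneg _) (Nat.cast_nonneg _)

theorem b_le_one (c : Fin C) : S.b c ≤ 1 := by
  refine div_le_one_of_le₀ ?_ (Nat.cast_nonneg N)
  exact_mod_cast (Finset.card_filter_le _ _).trans (by simp)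

variable {Q}

theorem IsPlan.L_nonneg (hQ : S.IsPlan Q) (c : Fin C) : 0 ≤ S.L Q c :=
  Finset.sum_nonneg fun d _ => mul_nonneg (S.a_nonneg c d) (hQ.nonneg c d)

theorem IsPlan.drift_le (hQ : S.IsPlan Q) (c : Fin C) (y : ℝ) :
    S.drift Q c y ≤ S.L Q c * (S.b c - y) := by
  rw [drift, L, Finset.sum_mul]
  refine Finset.sum_le_sum fun d _ => ?_
  have h := Real.one_sub_le_exp_neg (S.a c d * (S.b c - y))
  rw [← neg_mul] at h
  calc _ ≤ S.a c d * (S.b c - y) * Q c d :=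
        mul_le_mul_of_nonneg_right (by linarith) (hQ.nonneg c d)
    _ = _ := by ring

theorem IsPlan.drift_nonneg (hQ : S.IsPlan Q) {c : Fin C} {y : ℝ} (hy : y ≤ S.b c) :
    0 ≤ S.drift Q c y := by
  refine Finset.sum_nonneg fun d _ => mul_nonneg (sub_nonneg.2 (Real.exp_le_one_iff.2 ?_))
    (hQ.nonneg c d)
  rw [neg_mul]
  exact neg_nonpos.2 (mul_nonneg (S.a_nonneg c d) (sub_nonneg.2 hy))

theorem IsPlan.drift_le_one (hQ : S.IsPlan Q) (c : Fin C) (y : ℝ) : S.drift Q c y ≤ 1 := by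
  refine le_trans (Finset.sum_le_sum (g := Q c) fun d _ => ?_)
    ((hQ.sum_right c).le.trans (S.b_le_one c))
  exact mul_le_of_le_one_left (hQ.nonneg c d) (by linarith [Real.exp_pos (-S.a c d * (S.b c - y))])

theorem IsPlan.abs_drift_sub_le (hQ : S.IsPlan Q) {c : Fin C} {y z : ℝ} (hy : y ≤ S.b c)
    (hz : z ≤ S.b c) : |S.drift Q c y - S.drift Q c z| ≤ S.L Q c * |y - z| := by
  rw [drift, drift, L, ← Finset.sum_sub_distrib, Finset.sum_mul]
  refine (Finset.abs_sum_le_sum_abs _ _).trans (Finset.sum_le_sum fun d _ => ?_)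
  have hneg : ∀ w ≤ S.b c, -S.a c d * (S.b c - w) ≤ 0 := fun w hw => by
    rw [neg_mul]
    exact neg_nonpos.2 (mul_nonneg (S.a_nonneg c d) (sub_nonneg.2 hw))
  have h := abs_exp_sub_exp_le (hneg z hz) (hneg y hy)
  have h2 : -S.a c d * (S.b c - z) - -S.a c d * (S.b c - y) = -(S.a c d * (y - z)) := by ring
  rw [h2, abs_neg, abs_mul, abs_of_nonneg (S.a_nonneg c d)] at h
  rw [← sub_mul, abs_mul, abs_of_nonneg (hQ.nonneg c d), sub_sub_sub_cancel_left]
  calc _ ≤ S.a c d * |y - z| * Q c d := mul_le_mul_of_nonneg_right h (hQ.nonneg c d)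
    _ = _ := by ring

/-- Second-order Taylor bound `exp (-x) ≤ 1 - x + x ^ 2 / 2` at `x = a (b - y)`; since `y ≥ 0`, the
quadratic term is at most `(a b) ^ 2 / 2`, and these terms sum to `J`. -/
theorem IsPlan.le_drift (hQ : S.IsPlan Q) {c : Fin C} {y : ℝ} (h0 : 0 ≤ y) (hy : y ≤ S.b c) :
    S.L Q c * (S.b c - y) - S.J Q c ≤ S.drift Q c y := by
  rw [drift, L, J, Finset.sum_mul, Finset.mul_sum, ← Finset.sum_sub_distrib]
  refine Finset.sum_le_sum fun d _ => ?_
  have hx : 0 ≤ S.a c d * (S.b c - y) := mul_nonneg (S.a_nonneg c d) (sub_nonneg.2 hy)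
  have h1 : Real.exp (-S.a c d * (S.b c - y)) ≤ 1 - S.a c d * (S.b c - y) +
      (S.a c d * (S.b c - y)) ^ 2 / 2 := by
    have h2 := Real.quadratic_le_exp_of_nonneg hx
    rw [neg_mul, Real.exp_neg]
    refine inv_le_of_inv_le₀ (by nlinarith) (le_trans ?_ h2)
    rw [inv_le_iff_one_le_mul₀ (by nlinarith)]
    -- `(1 - x + x ^ 2 / 2) (1 + x + x ^ 2 / 2) = 1 + x ^ 4 / 4`.
    nlinarith [pow_nonneg hx 4, sq_nonneg (S.a c d * (S.b c - y))]
  have h3 : (S.a c d * (S.b c - y)) ^ 2 ≤ (S.a c d * S.b c) ^ 2 :=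
    pow_le_pow_left₀ hx (mul_le_mul_of_nonneg_left (by linarith) (S.a_nonneg c d)) 2
  calc _ = (S.a c d * (S.b c - y) - (S.a c d * S.b c) ^ 2 / 2) * Q c d := by ring
    _ ≤ _ := mul_le_mul_of_nonneg_right (by linarith) (hQ.nonneg c d)

variable {α : ℝ} {c : Fin C} {y : ℝ → ℝ}

theorem IsFluidSolution.hasDerivWithinAt (hy : S.IsFluidSolution Q α c y) {s : ℝ}
    (hs : s ∈ Set.Icc 0 α) : HasDerivWithinAt y (S.drift Q c (y s)) (Set.Icc 0 α) s := hy.2 s hs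

/-- `drift_le` holds for every real `y`, so no a priori bound on the solution is needed. This bound
gives `y ≤ b`, then nonnegativity of the drift and of `y`, and only then does `le_drift` become
available. -/
theorem IsPlan.solution_le (hQ : S.IsPlan Q) (hy : S.IsFluidSolution Q α c y) :
    ∀ s ∈ Set.Icc 0 α, y s ≤ S.b c - S.b c * Real.exp (-S.L Q c * s) := by
  intro s hs
  have h := mul_exp_le_of_deriv_le (y := y) (y' := fun s => S.drift Q c (y s)) (l := S.L Q c)
    (B := fun s => S.b c * (Real.exp (S.L Q c * s) - 1))
    (B' := fun s => S.b c * (Real.exp (S.L Q c * s) * (S.L Q c * 1)))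
    (fun s hs => hy.hasDerivWithinAt S hs)
    (fun s => ((((hasDerivAt_id s).const_mul _).exp.sub_const 1).const_mul _)) (by simp [hy.1])
    (fun s _ => by
      have := mul_le_mul_of_nonneg_right (hQ.drift_le S c (y s)) (Real.exp_pos (S.L Q c * s)).le
      linarith) s hs
  rw [neg_mul, Real.exp_neg]
  have hpos := Real.exp_pos (S.L Q c * s)
  rw [← le_div_iff₀ hpos] at h
  refine h.trans (le_of_eq ?_)
  field_simp

theorem IsPlan.solution_le_b (hQ : S.IsPlan Q) (hy : S.IsFluidSolution Q α c y) :
    ∀ s ∈ Set.Icc 0 α, y s ≤ S.b c := fun s hs =>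
  (hQ.solution_le S hy s hs).trans
    (sub_le_self _ (mul_nonneg (S.b_nonneg c) (Real.exp_pos _).le))

theorem IsPlan.solution_nonneg (hQ : S.IsPlan Q) (hy : S.IsFluidSolution Q α c y) :
    ∀ s ∈ Set.Icc 0 α, 0 ≤ y s := by
  intro s hs
  have h := mul_exp_le_of_deriv_le (y := fun s => -y s) (y' := fun s => -S.drift Q c (y s))
    (l := 0) (B := fun _ => 0) (B' := fun _ => 0)
    (fun s hs => (hy.hasDerivWithinAt S hs).neg) (fun s => hasDerivAt_const s 0)
    (by simp [hy.1]) (fun s hs => by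
      simpa using hQ.drift_nonneg S (hQ.solution_le_b S hy s hs)) s hs
  simpa using h

/-- The bound on the deviation from the linearised solution. -/
theorem IsPlan.solution_error_le (hQ : S.IsPlan Q) (hy : S.IsFluidSolution Q α c y) :
    ∀ s ∈ Set.Icc 0 α, S.b c - S.b c * Real.exp (-S.L Q c * s) - y s ≤
      S.J Q c / S.L Q c * (1 - Real.exp (-S.L Q c * s)) := by
  intro s hs
  -- For `L = 0` the quotient `J / L` is `0` in Lean, and the claim reduces to `0 ≤ y s`.
  rcases (hQ.L_nonneg S c).eq_or_lt with hL | hL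
  · rw [← hL]
    simpa using hQ.solution_nonneg S hy s hs
  have h := mul_exp_le_of_deriv_le (y := fun s => -y s) (y' := fun s => -S.drift Q c (y s))
    (l := S.L Q c)
    (B := fun s => (S.J Q c / S.L Q c - S.b c) * (Real.exp (S.L Q c * s) - 1))
    (B' := fun s => (S.J Q c / S.L Q c - S.b c) * (Real.exp (S.L Q c * s) * (S.L Q c * 1)))
    (fun s hs => (hy.hasDerivWithinAt S hs).neg)
    (fun s => ((((hasDerivAt_id s).const_mul _).exp.sub_const 1).const_mul _)) (by simp [hy.1])
    (fun s hs => by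
      have := mul_le_mul_of_nonneg_right (hQ.le_drift S (hQ.solution_nonneg S hy s hs)
        (hQ.solution_le_b S hy s hs)) (Real.exp_pos (S.L Q c * s)).le
      have h2 : (S.J Q c / S.L Q c - S.b c) * (Real.exp (S.L Q c * s) * (S.L Q c * 1)) =
          (S.J Q c - S.b c * S.L Q c) * Real.exp (S.L Q c * s) := by
        field_simp
      rw [h2]
      linarith) s hs
  rw [neg_mul, Real.exp_neg]
  have hpos := Real.exp_pos (S.L Q c * s)
  rw [← le_div_iff₀ hpos] at h
  have h2 : (S.J Q c / S.L Q c - S.b c) * (Real.exp (S.L Q c * s) - 1) / Real.exp (S.L Q c * s) =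
      (S.J Q c / S.L Q c - S.b c) * (1 - (Real.exp (S.L Q c * s))⁻¹) := by
    field_simp
  rw [h2] at h
  linarith

theorem lipschitzOnWith_drift (hQ : S.IsPlan Q) (c : Fin C) :
    LipschitzOnWith (S.L Q c).toNNReal (S.drift Q c) (Set.Iic (S.b c)) :=
  LipschitzOnWith.of_dist_le_mul fun y hy z hz => by
    rw [Real.dist_eq, Real.dist_eq, Real.coe_toNNReal _ (hQ.L_nonneg S c)]
    exact hQ.abs_drift_sub_le S hy hz

/-- The drift has the Lipschitz constant `L` on `y ≤ b`, where its exponents are nonpositive, and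
every solution stays there by `solution_le_b`. -/
theorem IsPlan.solution_unique (hQ : S.IsPlan Q) {z : ℝ → ℝ} (hy : S.IsFluidSolution Q α c y)
    (hz : S.IsFluidSolution Q α c z) : Set.EqOn z y (Set.Icc 0 α) := by
  have hright : ∀ w, S.IsFluidSolution Q α c w → ∀ t ∈ Set.Ico 0 α,
      HasDerivWithinAt w (S.drift Q c (w t)) (Set.Ici t) t := fun w hw t ht =>
    (hw.hasDerivWithinAt S (Set.Ico_subset_Icc_self ht)).mono_of_mem_nhdsWithin
      (Icc_mem_nhdsGE_of_mem ht)
  exact ODE_solution_unique_of_mem_Icc_right (v := fun _ => S.drift Q c)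
    (s := fun _ => Set.Iic (S.b c)) (fun _ _ => S.lipschitzOnWith_drift hQ c)
    (fun s hs => (hz.hasDerivWithinAt S hs).continuousWithinAt) (hright z hz)
    (fun t ht => hQ.solution_le_b S hz t (Set.Ico_subset_Icc_self ht))
    (fun s hs => (hy.hasDerivWithinAt S hs).continuousWithinAt) (hright y hy)
    (fun t ht => hQ.solution_le_b S hy t (Set.Ico_subset_Icc_self ht)) (by rw [hz.1, hy.1])

theorem IsPlan.exists_solution (hQ : S.IsPlan Q) (hα : 0 ≤ α) (c : Fin C) :
    ∃ y, S.IsFluidSolution Q α c y := by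
  -- Truncation at `b` makes the drift globally `L`-Lipschitz with values in `[0, 1]`; speed at most
  -- 1 and radius `α` cover the whole time interval at once.
  have hpl : IsPicardLindelof (fun _ y => S.drift Q c (min y (S.b c)))
      (⟨0, Set.left_mem_Icc.2 hα⟩ : Set.Icc 0 α) 0 α.toNNReal 0 1 (S.L Q c).toNNReal :=
    { lipschitzOnWith := fun _ _ => LipschitzOnWith.of_dist_le_mul fun y _ z _ => by
        rw [Real.dist_eq, Real.dist_eq, Real.coe_toNNReal _ (hQ.L_nonneg S c)]
        refine (hQ.abs_drift_sub_le S (min_le_right _ _) (min_le_right _ _)).trans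
          (mul_le_mul_of_nonneg_left ?_ (hQ.L_nonneg S c))
        simpa using abs_min_sub_min_le_max y (S.b c) z (S.b c)
      continuousOn := fun _ _ => continuousOn_const
      norm_le := fun _ _ y _ => by
        rw [Real.norm_eq_abs, abs_of_nonneg (hQ.drift_nonneg S (min_le_right _ _))]
        exact hQ.drift_le_one S c _
      mul_max_le := by simp [hα] }
  obtain ⟨y, hy0, hy⟩ := hpl.exists_eq_forall_mem_Icc_hasDerivWithinAt₀
  have hle : ∀ s ∈ Set.Icc 0 α, y s ≤ S.b c := by
    intro s hs
    refine le_of_forall_pos_le_add fun ε hε => ?_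
    have h1 : 0 < 1 + s := by linarith [hs.1]
    -- The truncation is never active. The barrier has positive slope and equals `b + ε` at time
    -- `s`; where `y` meets it, `y ≥ b`, so the truncated drift is at most `L * 0 = 0`.
    have h := image_le_of_deriv_right_lt_deriv_boundary' (f := y) (a := 0) (b := α)
      (f' := fun s => S.drift Q c (min (y s) (S.b c)))
      (fun s hs => (hy s hs).continuousWithinAt)
      (fun t ht => (hy t (Set.Ico_subset_Icc_self ht)).mono_of_mem_nhdsWithin
        (Icc_mem_nhdsGE_of_mem ht))
      (B := fun t => S.b c + ε / (1 + s) * (1 + t)) (B' := fun _ => ε / (1 + s) * 1)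
      (by
        have h0 : y 0 = 0 := hy0
        rw [h0]
        have := S.b_nonneg c
        positivity) (by fun_prop)
      (fun t _ => (((hasDerivAt_id t).const_add 1).const_mul _).const_add _ |>.hasDerivWithinAt)
      (fun t ht hyt => by
        have h2 : S.b c ≤ y t := by
          rw [hyt]
          have : 0 ≤ t := ht.1
          exact le_add_of_nonneg_right (by positivity)
        rw [min_eq_right h2]
        refine (hQ.drift_le S c (S.b c)).trans_lt ?_
        rw [sub_self, mul_zero]
        positivity) hs
    rwa [div_mul_cancel₀ _ h1.ne'] at h
  refine ⟨y, hy0, fun s hs => ?_⟩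
  have := hy s hs
  rwa [min_eq_left (hle s hs)] at this

end BlockModel

/-! ### Elementary inequalities for the stochastic comparison -/

/-- Hoeffding's bound for the centred Bernoulli law. -/
theorem bernoulli_mgf_le {r : ℝ} (h0 : 0 ≤ r) (h1 : r ≤ 1) (θ : ℝ) :
    r * Real.exp ((1 - r) * θ) + (1 - r) * Real.exp (-r * θ) ≤ Real.exp (θ ^ 2 / 2) := by
  -- Convexity gives `exp (t θ) ≤ cosh θ + t sinh θ` for `|t| ≤ 1`; the `sinh` terms cancel because
  -- the law is centred.
  have e1 := mul_le_mul_of_nonneg_left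
    (Real.exp_mul_le_cosh_add_mul_sinh (t := 1 - r) (abs_le.2 ⟨by linarith, by linarith⟩) θ) h0
  have e2 := mul_le_mul_of_nonneg_left
    (Real.exp_mul_le_cosh_add_mul_sinh (t := -r) (abs_le.2 ⟨by linarith, by linarith⟩) θ)
    (sub_nonneg.2 h1)
  have e3 := Real.cosh_le_exp_half_sq θ
  linarith

theorem one_sub_pow_le_exp {x : ℝ} (h1 : x ≤ 1) (u : ℕ) : (1 - x) ^ u ≤ Real.exp (-x * u) := by
  rw [mul_comm, Real.exp_nat_mul]
  exact pow_le_pow_left₀ (sub_nonneg.2 h1) (Real.one_sub_le_exp_neg x) u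

/-- The error bound is uniform in `u`: one factor `exp (-x) ≤ 1 - x + x ^ 2` turns an error `x` into
at most `x (1 - x) + x ^ 2 = x`. -/
theorem exp_le_one_sub_pow_add {x : ℝ} (h0 : 0 ≤ x) (h1 : x ≤ 1) (u : ℕ) :
    Real.exp (-x * u) ≤ (1 - x) ^ u + x := by
  have hx : Real.exp (-x) ≤ 1 - x + x ^ 2 := by
    rw [Real.exp_neg]
    refine inv_le_of_inv_le₀ (by nlinarith) (le_trans ?_ (Real.add_one_le_exp x))
    rw [inv_le_iff_one_le_mul₀ (by nlinarith)]
    nlinarith [pow_nonneg h0 3]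
  induction u with
  | zero => simpa using h0
  | succ u ih =>
    have h2 : Real.exp (-x * (u + 1 : ℕ)) = Real.exp (-x * u) * Real.exp (-x) := by
      rw [← Real.exp_add]
      push_cast
      ring_nf
    have h3 : Real.exp (-x * u) ≤ 1 := Real.exp_le_one_iff.2 (by
      rw [neg_mul]
      exact neg_nonpos.2 (by positivity))
    have h4 := Real.one_sub_le_exp_neg x
    rw [h2, pow_succ]
    nlinarith [mul_le_mul_of_nonneg_right ih (sub_nonneg.2 h1),
      mul_le_mul_of_nonneg_right h3 (sub_nonneg.2 h4)]

/-- A discrete Gronwall inequality. -/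
theorem discrete_gronwall {E : ℕ → ℝ} {A B h : ℝ} (hh : 0 ≤ h) {T : ℕ}
    (hE : ∀ k ≤ T, E k ≤ A + h * B * k + h * ∑ j ∈ Finset.range k, E j) :
    ∀ k ≤ T, E k + B ≤ (A + B) * (1 + h) ^ k := by
  -- The induction runs on the right-hand side of `hE`: after adding `B`, it grows by at most the
  -- factor `1 + h` per step.
  have key : ∀ k ≤ T, A + h * B * k + h * ∑ j ∈ Finset.range k, E j + B ≤
      (A + B) * (1 + h) ^ k := by
    intro k
    induction k with
    | zero => simp
    | succ k ih =>
      intro hk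
      have h1 := ih (by omega)
      have h2 := mul_le_mul_of_nonneg_left (hE k (by omega)) hh
      have h3 := mul_le_mul_of_nonneg_right h1 (by linarith : 0 ≤ 1 + h)
      rw [Finset.sum_range_succ, pow_succ]
      push_cast
      nlinarith
  intro k hk
  linarith [key k hk, hE k hk]

/-! ### Martingale fluctuations and comparison with the fluid limit -/

namespace BlockModel

variable {N C D : ℕ} (S : BlockModel N C D) {Q : Fin C → Fin D → ℝ} {T : ℕ}

theorem b_eq (c : Fin C) : S.b c = S.classSize c / N := rfl

theorem matchedCount_div_le (c : Fin C) (A : Matching N T) :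
    (S.matchedCount c A : ℝ) / N ≤ S.b c := by
  rw [b_eq]
  have : (S.matchedCount c A : ℝ) ≤ S.classSize c := by exact_mod_cast S.matchedCount_le c A
  gcongr

theorem IsPlan.rate_le_one (hQ : S.IsPlan Q) (c : Fin C) (k : ℕ) : S.rate Q c k ≤ 1 := by
  refine le_trans (Finset.sum_le_sum (g := Q c) fun d _ => ?_)
    ((hQ.sum_right c).le.trans (S.b_le_one c))
  exact mul_le_of_le_one_right (hQ.nonneg c d)
    (sub_le_self _ (pow_nonneg (sub_nonneg.2 (S.p_le_one c d)) _))

/-- At `y = k / N` the exponential is `exp (-p u)`, where `u` is the number of unmatched nodes; it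
differs from `(1 - p) ^ u` by at most `p`, and `∑ d, Q c d * p c d = L / N`. -/
theorem IsPlan.abs_rate_sub_drift_le (hQ : S.IsPlan Q) (c : Fin C) {k : ℕ}
    (hk : k ≤ S.classSize c) : |S.rate Q c k - S.drift Q c (k / N)| ≤ S.L Q c / N := by
  rw [rate, drift, L, ← Finset.sum_sub_distrib, Finset.sum_div]
  refine (Finset.abs_sum_le_sum_abs _ _).trans (Finset.sum_le_sum fun d _ => ?_)
  have h1 : -S.a c d * (S.b c - k / N) = -S.p c d * (S.classSize c - k : ℕ) := by
    rw [b_eq, p, Nat.cast_sub hk]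
    ring
  have h2 := one_sub_pow_le_exp (S.p_le_one c d) (S.classSize c - k)
  have h3 := exp_le_one_sub_pow_add (S.p_nonneg c d) (S.p_le_one c d) (S.classSize c - k)
  rw [h1, mul_comm, ← sub_mul, abs_mul, abs_of_nonneg (hQ.nonneg c d), mul_div_right_comm]
  refine mul_le_mul_of_nonneg_right ?_ (hQ.nonneg c d)
  rw [← p]
  exact abs_le.2 ⟨by linarith, by linarith [S.p_nonneg c d]⟩

variable (Q) in
/-- The martingale part of the number of matched nodes of class `c` after `k` arrivals. -/
noncomputable def fluctuation (c : Fin C) (m : ℕ → Matching N T) (k : ℕ) : ℝ :=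
  S.matchedCount c (m k) - ∑ j ∈ Finset.range k, S.rate Q c (S.matchedCount c (m j))

theorem fluctuation_update_of_le (c : Fin C) (m : ℕ → Matching N T) {j k : ℕ} (hj : j ≤ k)
    (A : Matching N T) :
    S.fluctuation Q c (Function.update m (k + 1) A) j = S.fluctuation Q c m j := by
  have h : ∀ i ≤ j, Function.update m (k + 1) A i = m i := fun i hi =>
    Function.update_of_ne (by omega) _ _
  rw [fluctuation, fluctuation, h j le_rfl]
  congr 1
  exact Finset.sum_congr rfl fun i hi => by rw [h i (Finset.mem_range.1 hi).le]

theorem fluctuation_update_succ (c : Fin C) (m : ℕ → Matching N T) (k : ℕ) (A : Matching N T) :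
    S.fluctuation Q c (Function.update m (k + 1) A) (k + 1) =
      S.fluctuation Q c m k + (S.matchedCount c A - S.matchedCount c (m k)) -
        S.rate Q c (S.matchedCount c (m k)) := by
  have h : ∀ i ≤ k, Function.update m (k + 1) A i = m i := fun i hi =>
    Function.update_of_ne (by omega) _ _
  rw [fluctuation, fluctuation, Function.update_self, Finset.sum_range_succ, h k le_rfl,
    Finset.sum_congr rfl fun i hi => by rw [h i (Finset.mem_range.1 hi).le]]
  ring

/-- The maximal inequality for the exponential supermartingale. -/
theorem IsPlan.avg_fluctuation_le [NeZero C] (hQ : S.IsPlan Q) (c : Fin C) (θ : ℝ) {ρ : ℝ}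
    (hρ : 0 < ρ) :
    avg (S.myopicLaw Q T)
        ({m | ∃ k ≤ T, ρ ≤ θ * S.fluctuation Q c m k}.indicator fun _ => 1) ≤
      ENNReal.ofReal (Real.exp (T * θ ^ 2 / 2 - ρ)) := by
  classical
  -- The process is frozen at 1 once the level `ρ` is reached. Before that, `(T - k) θ ^ 2 / 2` is
  -- the budget for the remaining arrivals, each of which spends at most `θ ^ 2 / 2` by
  -- `bernoulli_mgf_le`.
  let f : ℕ → (ℕ → Matching N T) → ℝ≥0∞ := fun k m =>
    if ∃ j ≤ k, ρ ≤ θ * S.fluctuation Q c m j then 1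
    else ENNReal.ofReal
      (Real.exp (θ * S.fluctuation Q c m k + ((T : ℝ) - k) * θ ^ 2 / 2 - ρ))
  have h0 : f 0 (fun _ => ∅) = ENNReal.ofReal (Real.exp (T * θ ^ 2 / 2 - ρ)) := by
    have hz : S.fluctuation Q c (fun _ => (∅ : Matching N T)) 0 = 0 := by
      simp [fluctuation, matchedCount]
    have : ¬∃ j ≤ 0, ρ ≤ θ * S.fluctuation Q c (fun _ => (∅ : Matching N T)) j := by
      rintro ⟨j, hj, h⟩
      obtain rfl : j = 0 := by omega
      rw [hz, mul_zero] at h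
      exact absurd h (not_le.2 hρ)
    simp only [f]
    rw [if_neg this, hz]
    simp
  rw [← h0]
  refine le_trans (avg_mono _ fun m => ?_) (S.avg_myopicLaw_le Q f ?_)
  · by_cases h : ∃ j ≤ T, ρ ≤ θ * S.fluctuation Q c m j
    · simp only [f]
      rw [if_pos h]
      exact Set.indicator_le_self' (fun _ _ => zero_le) m
    · refine (Set.indicator_of_notMem ?_ _).le.trans zero_le
      exact h
  · intro k m x
    by_cases h : ∃ j ≤ (k : ℕ), ρ ≤ θ * S.fluctuation Q c m j
    · have h1 : ∀ A, f (k + 1) (Function.update m (k + 1) A) = 1 := by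
        intro A
        obtain ⟨j, hj, h⟩ := h
        exact if_pos ⟨j, by omega, by rwa [S.fluctuation_update_of_le c m hj]⟩
      simp only [h1, avg_const]
      simp only [f]
      rw [if_pos h]
    · set M := S.matchedCount c (m k) with hM
      set r := S.rate Q c M with hr
      set Z := S.fluctuation Q c m k with hZ
      let φ : ℕ → ℝ≥0∞ := fun M' => ENNReal.ofReal (Real.exp
        (θ * (Z + ((M' : ℝ) - M) - r) + ((T : ℝ) - (k + 1 : ℕ)) * θ ^ 2 / 2 - ρ))
      have h1 : ∀ A, f (k + 1) (Function.update m (k + 1) A) ≤ φ (S.matchedCount c A) := by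
        intro A
        simp only [f, φ]
        rw [S.fluctuation_update_succ]
        split_ifs with h2
        · obtain ⟨j, hj, h2⟩ := h2
          rcases Nat.lt_or_ge k j with hjk | hjk
          · obtain rfl : j = k + 1 := by omega
            rw [S.fluctuation_update_succ] at h2
            -- At a first crossing the frozen value 1 is still below `φ`, because the remaining
            -- budget is nonnegative.
            rw [ENNReal.one_le_ofReal]
            refine Real.one_le_exp ?_
            have hkT : ((k + 1 : ℕ) : ℝ) ≤ T := by exact_mod_cast k.2
            have := mul_nonneg (sub_nonneg.2 hkT) (sq_nonneg θ)
            linarith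
          · rw [S.fluctuation_update_of_le c m hjk] at h2
            exact absurd ⟨j, hjk, h2⟩ h
        · exact le_rfl
      refine (avg_mono _ fun v => avg_mono _ h1).trans ?_
      rw [hQ.avg_arrival S x k (m k) c φ]
      simp only [f, φ]
      rw [if_neg h, ← hM, ← hr, ← hZ, ← ENNReal.ofReal_mul (hQ.rate_nonneg S c _),
        ← ENNReal.ofReal_mul (sub_nonneg.2 (hQ.rate_le_one S c _)),
        ← ENNReal.ofReal_add (mul_nonneg (hQ.rate_nonneg S c _) (Real.exp_pos _).le)
          (mul_nonneg (sub_nonneg.2 (hQ.rate_le_one S c _)) (Real.exp_pos _).le)]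
      refine ENNReal.ofReal_le_ofReal ?_
      set X := θ * Z + ((T : ℝ) - (k + 1 : ℕ)) * θ ^ 2 / 2 - ρ with hX
      have e1 : θ * (Z + (((M + 1 : ℕ) : ℝ) - M) - r) + ((T : ℝ) - (k + 1 : ℕ)) * θ ^ 2 / 2 - ρ =
          X + (1 - r) * θ := by
        rw [hX]
        push_cast
        ring
      have e2 : θ * (Z + ((M : ℝ) - M) - r) + ((T : ℝ) - (k + 1 : ℕ)) * θ ^ 2 / 2 - ρ =
          X + -r * θ := by
        rw [hX]
        ring
      have e3 : θ * Z + ((T : ℝ) - k) * θ ^ 2 / 2 - ρ = X + θ ^ 2 / 2 := by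
        rw [hX]
        push_cast
        ring
      rw [e1, e2, e3, Real.exp_add, Real.exp_add, Real.exp_add]
      have := mul_le_mul_of_nonneg_left (bernoulli_mgf_le (hQ.rate_nonneg S c M)
        (hQ.rate_le_one S c M) θ) (Real.exp_pos X).le
      linarith

variable {α : ℝ} {c : Fin C} {y : ℝ → ℝ}

/-- One step of the Euler scheme for the fluid equation. -/
theorem IsPlan.abs_euler_step_le (hQ : S.IsPlan Q) (hy : S.IsFluidSolution Q α c y) {s t : ℝ}
    (hs : 0 ≤ s) (hst : s ≤ t) (ht : t ≤ α) :
    |y t - y s - (t - s) * S.drift Q c (y s)| ≤ S.L Q c * (t - s) ^ 2 := by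
  have hsub : Set.Icc s t ⊆ Set.Icc 0 α := Set.Icc_subset_Icc hs ht
  have hsmem : s ∈ Set.Icc s t := Set.left_mem_Icc.2 hst
  -- The drift lies in `[0, 1]`, so `y` moves by at most `t - s`; the drift then changes by at most
  -- `L (t - s)` along the segment.
  have h1 : ∀ u ∈ Set.Icc s t, |y u - y s| ≤ t - s := by
    intro u hu
    have h := (convex_Icc s t).norm_image_sub_le_of_norm_hasDerivWithin_le (f := y)
      (f' := fun u => S.drift Q c (y u)) (C := 1)
      (fun u hu => (hy.hasDerivWithinAt S (hsub hu)).mono hsub) (fun u hu => by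
        rw [Real.norm_eq_abs, abs_of_nonneg (hQ.drift_nonneg S
          (hQ.solution_le_b S hy u (hsub hu)))]
        exact hQ.drift_le_one S c _) hsmem hu
    rw [one_mul, Real.norm_eq_abs, Real.norm_eq_abs, abs_of_nonneg (sub_nonneg.2 hu.1)] at h
    exact h.trans (sub_le_sub_right hu.2 s)
  have h2 := norm_image_sub_le_of_norm_deriv_le_segment' (a := s) (b := t)
    (f := fun u => y u - u * S.drift Q c (y s))
    (f' := fun u => S.drift Q c (y u) - 1 * S.drift Q c (y s)) (C := S.L Q c * (t - s))
    (fun u hu => ((hy.hasDerivWithinAt S (hsub hu)).mono hsub).sub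
      ((hasDerivAt_id u).mul_const _).hasDerivWithinAt)
    (fun u hu => by
      have hu' := Set.Ico_subset_Icc_self hu
      rw [one_mul, Real.norm_eq_abs]
      exact (hQ.abs_drift_sub_le S (hQ.solution_le_b S hy u (hsub hu'))
        (hQ.solution_le_b S hy s (hsub hsmem))).trans
          (mul_le_mul_of_nonneg_left (h1 u hu') (hQ.L_nonneg S c)))
    t (Set.right_mem_Icc.2 hst)
  rw [Real.norm_eq_abs] at h2
  convert h2 using 1
  · congr 1
    ring
  · ring

/-- On the event that the fluctuations are small, the number of matched nodes follows the
solution of the fluid equation. -/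
theorem IsPlan.abs_matchedCount_sub_solution_le (hQ : S.IsPlan Q) (hN : 0 < N)
    (hT : (T : ℝ) = α * N) (hy : S.IsFluidSolution Q α c y) {m : ℕ → Matching N T} {l : ℝ}
    (hm : ∀ k ≤ T, |S.fluctuation Q c m k| ≤ l) :
    ∀ k ≤ T, |(S.matchedCount c (m k) : ℝ) / N - y ((k : ℝ) / N)| ≤
      (l / N + 2 / N) * Real.exp (α * S.L Q c) := by
  have hN' : (0 : ℝ) < N := by exact_mod_cast hN
  have hL := hQ.L_nonneg S c
  have hkα : ∀ k ≤ T, (k : ℝ) / N ≤ α := fun k hk => by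
    rw [div_le_iff₀ hN', ← hT]
    exact_mod_cast hk
  set M : ℕ → ℝ := fun k => S.matchedCount c (m k) / N with hM
  set E : ℕ → ℝ := fun k => |M k - y ((k : ℝ) / N)| with hE
  set F : ℕ → ℝ := fun k =>
    S.rate Q c (S.matchedCount c (m k)) / N - (y (((k + 1 : ℕ) : ℝ) / N) - y ((k : ℝ) / N)) with hF
  have hdecomp : ∀ k, M k - y ((k : ℝ) / N) =
      S.fluctuation Q c m k / N + ∑ j ∈ Finset.range k, F j := by
    intro k
    rw [hF, Finset.sum_sub_distrib, Finset.sum_range_sub (fun j : ℕ => y ((j : ℝ) / N)),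
      ← Finset.sum_div, fluctuation, hM, Nat.cast_zero, zero_div, hy.1]
    ring
  -- Replacing the rate by the drift and taking one Euler step each cost `L / N ^ 2`, whence the `2
  -- / N`; the Lipschitz bound contributes the term with `E k`.
  have hFle : ∀ k < T, |F k| ≤ S.L Q c / N * (2 / N) + S.L Q c / N * E k := by
    intro k hk
    have hk0 : (0 : ℝ) ≤ (k : ℝ) / N := by positivity
    have hlen : ((k + 1 : ℕ) : ℝ) / N - (k : ℝ) / N = 1 / N := by
      push_cast
      ring
    have h1 := hQ.abs_euler_step_le S hy hk0 (t := ((k + 1 : ℕ) : ℝ) / N)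
      (by gcongr; omega) (hkα (k + 1) hk)
    rw [hlen] at h1
    have h2 := hQ.abs_rate_sub_drift_le S c (S.matchedCount_le c (m k))
    have h3 := hQ.abs_drift_sub_le S (S.matchedCount_div_le c (m k))
      (hQ.solution_le_b S hy ((k : ℝ) / N) ⟨hk0, hkα k hk.le⟩)
    have hsplit : F k = (S.rate Q c (S.matchedCount c (m k)) - S.drift Q c (M k)) * (1 / N) +
        (S.drift Q c (M k) - S.drift Q c (y ((k : ℝ) / N))) * (1 / N) -
        (y (((k + 1 : ℕ) : ℝ) / N) - y ((k : ℝ) / N) -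
          1 / N * S.drift Q c (y ((k : ℝ) / N))) := by
      rw [hF]
      ring
    have hinv : (0 : ℝ) ≤ 1 / N := by positivity
    rw [hsplit]
    refine (abs_sub _ _).trans ((add_le_add (abs_add_le _ _) h1).trans ?_)
    rw [abs_mul, abs_mul, abs_of_nonneg hinv]
    have h4 := mul_le_mul_of_nonneg_right h2 hinv
    have h5 := mul_le_mul_of_nonneg_right h3 hinv
    refine (add_le_add_left (add_le_add h4 h5) _).trans (le_of_eq ?_)
    rw [hE]
    ring
  have hrec : ∀ k ≤ T, E k ≤ l / N + S.L Q c / N * (2 / N) * k +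
      S.L Q c / N * ∑ j ∈ Finset.range k, E j := by
    intro k hk
    have h1 : |∑ j ∈ Finset.range k, F j| ≤
        ∑ j ∈ Finset.range k, (S.L Q c / N * (2 / N) + S.L Q c / N * E j) :=
      (Finset.abs_sum_le_sum_abs _ _).trans (Finset.sum_le_sum fun j hj =>
        hFle j ((Finset.mem_range.1 hj).trans_le hk))
    rw [Finset.sum_add_distrib, Finset.sum_const, Finset.card_range, nsmul_eq_mul,
      ← Finset.mul_sum] at h1
    have h2 : |S.fluctuation Q c m k / N| ≤ l / N := by
      rw [abs_div, abs_of_pos hN']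
      exact div_le_div_of_nonneg_right (hm k hk) hN'.le
    have h3 : E k ≤ _ := (congrArg abs (hdecomp k)).le.trans (abs_add_le _ _)
    linarith
  intro k hk
  have h1 := discrete_gronwall (div_nonneg hL hN'.le) hrec k hk
  have hl : 0 ≤ l := (abs_nonneg _).trans (hm k hk)
  have h2 : (1 + S.L Q c / N) ^ k ≤ Real.exp (α * S.L Q c) := by
    have h3 : 1 + S.L Q c / N ≤ Real.exp (S.L Q c / N) := by
      rw [add_comm]
      exact Real.add_one_le_exp _
    refine (pow_le_pow_left₀ (by positivity) h3 k).trans ?_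
    rw [← Real.exp_nat_mul]
    refine Real.exp_le_exp.2 ?_
    have := mul_le_mul_of_nonneg_right (hkα k hk) hL
    calc (k : ℝ) * (S.L Q c / N) = k / N * S.L Q c := by ring
      _ ≤ _ := this
  have h4 := mul_le_mul_of_nonneg_left h2 (by positivity : 0 ≤ l / N + 2 / N)
  have h5 : (0 : ℝ) ≤ 2 / N := by positivity
  linarith

end BlockModel

/-! ### Choice of the level and conclusion -/

/-- A lower bound for the probability of an event whose complement is covered by two events. -/
theorem one_sub_le_toOuterMeasure {β : Type*} (p : PMF β) {s t u : Set β} {ε : ℝ} (hε : 0 ≤ ε)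
    (hst : ∀ x, x ∈ s ∨ x ∈ t ∨ x ∈ u) (ht : avg p (t.indicator fun _ => 1) ≤ ENNReal.ofReal ε)
    (hu : avg p (u.indicator fun _ => 1) ≤ ENNReal.ofReal ε) :
    1 - 2 * ε ≤ (p.toOuterMeasure s).toReal := by
  classical
  have h1 : 1 ≤ p.toOuterMeasure s + (ENNReal.ofReal ε + ENNReal.ofReal ε) := by
    refine le_trans ?_ (add_le_add le_rfl (add_le_add ht hu))
    rw [toOuterMeasure_eq_avg, ← avg_add, ← avg_add]
    refine (avg_const p 1).ge.trans (avg_mono p fun x => ?_)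
    rcases hst x with h | h | h <;> simp [h]
    · rw [add_left_comm]
      exact le_self_add
    · rw [← add_assoc]
      exact le_add_self
  have h2 : p.toOuterMeasure s ≠ ⊤ := ne_top_of_le_ne_top ENNReal.one_ne_top (by
    rw [toOuterMeasure_eq_avg]
    exact (avg_mono p fun x => Set.indicator_le_self' (fun _ _ => zero_le) x).trans_eq
      (avg_const p 1))
  rw [← ENNReal.ofReal_add hε hε] at h1
  have h3 := ENNReal.toReal_mono (ENNReal.add_ne_top.2 ⟨h2, ENNReal.ofReal_ne_top⟩) h1
  rw [ENNReal.toReal_add h2 ENNReal.ofReal_ne_top, ENNReal.toReal_ofReal (by positivity),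
    ENNReal.toReal_one] at h3
  linarith

namespace BlockModel

variable {N C D : ℕ} (S : BlockModel N C D) {Q : Fin C → Fin D → ℝ} {T : ℕ}

/-- The number of matched nodes is close to the fluid limit with high probability. -/
theorem IsPlan.concentration [NeZero C] (hQ : S.IsPlan Q) (hN : 0 < N) {α : ℝ} (hα : 0 < α)
    (hT : (T : ℝ) = α * N) {c : Fin C} {y : ℝ → ℝ} (hy : S.IsFluidSolution Q α c y) :
    1 - 2 * (C : ℝ) * Real.exp (-((N : ℝ) ^ (1 / 3 : ℝ) * S.L Q c ^ 2 / (8 * α))) ≤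
      ((S.myopicLaw Q T).toOuterMeasure
        {m | ∀ t : ℕ, t ≤ T →
          |(S.matchedCount c (m t) : ℝ) / N - y ((t : ℝ) / N)| ≤
            3 * S.L Q c * Real.exp (α * S.L Q c) / (N : ℝ) ^ (1 / 3 : ℝ)}).toReal := by
  have hN' : (0 : ℝ) < N := by exact_mod_cast hN
  have hTpos : (0 : ℝ) < T := hT ▸ mul_pos hα hN'
  have hT1 : (1 : ℝ) ≤ T := by
    have : 0 < T := by exact_mod_cast hTpos
    exact_mod_cast this
  have hC : (1 : ℝ) ≤ C := by exact_mod_cast NeZero.one_le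
  obtain ⟨g, hg, hgN⟩ : ∃ g : ℝ, 0 < g ∧ g ^ 3 = N ∧ (N : ℝ) ^ (1 / 3 : ℝ) = g := by
    refine ⟨(N : ℝ) ^ (1 / 3 : ℝ), Real.rpow_pos_of_pos hN' _, ?_, rfl⟩
    rw [← Real.rpow_natCast, ← Real.rpow_mul hN'.le]
    norm_num
  rw [hgN.2]
  have hg3 := hgN.1
  have hL := hQ.L_nonneg S c
  set l := S.L Q c with hl
  have hexp := Real.exp_pos (-(g * l ^ 2 / (8 * α)))
  -- For a single class the bound holds even without the factor `C ≥ 1`.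
  refine le_trans (b := 1 - 2 * Real.exp (-(g * l ^ 2 / (8 * α)))) (by nlinarith) ?_
  -- With level `r = g ^ 2 l / 2` and `N = g ^ 3`, the requirement `(r + 2) / N ≤ 3 l / g` is
  -- exactly `g ^ 2 l ≥ 4 / 5`. Below this threshold, `T ≥ 1` forces the exponent to be at most `1 /
  -- 2`, and the claimed probability bound is nonpositive.
  rcases lt_or_ge (g ^ 2 * l) (4 / 5) with hsmall | hlarge
  · refine le_trans ?_ ENNReal.toReal_nonneg
    have h1 : g * l ^ 2 / (8 * α) ≤ 1 / 2 := by
      have h2 : (g ^ 2 * l) ^ 2 ≤ 1 := by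
        have : 0 ≤ g ^ 2 * l := by positivity
        nlinarith
      rw [div_le_iff₀ (by positivity)]
      have h3 : g ^ 3 * (g * l ^ 2) ≤ g ^ 3 * (1 / 2 * (8 * α)) := by
        rw [hT, ← hg3] at hT1
        calc g ^ 3 * (g * l ^ 2) = (g ^ 2 * l) ^ 2 := by ring
          _ ≤ 4 * (α * g ^ 3) := by linarith
          _ = _ := by ring
      exact le_of_mul_le_mul_left h3 (by positivity)
    have := Real.one_sub_le_exp_neg (g * l ^ 2 / (8 * α))
    linarith
  · have hlpos : 0 < l := by
      by_contra h
      have : l = 0 := le_antisymm (not_lt.1 h) hL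
      rw [this, mul_zero] at hlarge
      norm_num at hlarge
    set r := g ^ 2 * l / 2 with hr
    have hrpos : 0 < r := by positivity
    have hexponent : ∀ θ : ℝ, θ ^ 2 = (r / T) ^ 2 →
        T * θ ^ 2 / 2 - r ^ 2 / T = -(g * l ^ 2 / (8 * α)) := by
      intro θ hθ
      rw [hθ, hr, hT, ← hg3]
      field_simp
      ring
    -- `θ = r / T` minimises `T θ ^ 2 / 2 - θ r`; the minimum `-r ^ 2 / (2 T)` is the stated
    -- exponent. The opposite sign of `θ` handles the lower tail.
    have hplus := hQ.avg_fluctuation_le S (T := T) c (r / T) (ρ := r ^ 2 / T) (by positivity)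
    have hminus := hQ.avg_fluctuation_le S (T := T) c (-(r / T)) (ρ := r ^ 2 / T) (by positivity)
    rw [hexponent _ rfl] at hplus
    rw [hexponent _ (neg_sq _)] at hminus
    refine one_sub_le_toOuterMeasure _ hexp.le (fun m => ?_) hplus hminus
    by_cases hm : ∀ k ≤ T, |S.fluctuation Q c m k| ≤ r
    · left
      intro t ht
      refine (hQ.abs_matchedCount_sub_solution_le S hN hT hy hm t ht).trans ?_
      rw [mul_div_right_comm]
      refine mul_le_mul_of_nonneg_right ?_ (Real.exp_pos _).le
      rw [← add_div, ← hg3, div_le_div_iff₀ (by positivity) hg]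
      have := mul_le_mul_of_nonneg_left hlarge hg.le
      rw [hr]
      nlinarith
    · right
      push Not at hm
      obtain ⟨k, hk, hm⟩ := hm
      rcases lt_abs.1 hm with h | h
      · left
        refine ⟨k, hk, ?_⟩
        rw [div_mul_eq_mul_div, sq]
        gcongr
      · right
        refine ⟨k, hk, ?_⟩
        rw [neg_mul_comm, div_mul_eq_mul_div, sq]
        gcongr

end BlockModel

end Myopic

theorem mainTheorem2 {N C D T : ℕ} [NeZero C] (hN : 0 < N)
    (S : Myopic.BlockModel N C D) (α : ℝ) (hα : 0 < α) (hT : (T : ℝ) = α * N)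
    (Q : Fin C → Fin D → ℝ) (hQ : S.IsOptimalPlan Q) (c : Fin C) :
    ∃ y : ℝ → ℝ, S.IsFluidSolution Q α c y ∧
      (∀ z : ℝ → ℝ, S.IsFluidSolution Q α c z → Set.EqOn z y (Set.Icc 0 α)) ∧
      1 - 2 * (C : ℝ) * Real.exp (-((N : ℝ) ^ (1 / 3 : ℝ) * S.L Q c ^ 2 / (8 * α))) ≤
        ((S.myopicLaw Q T).toOuterMeasure
          {m | ∀ t : ℕ, t ≤ T →
            |(S.matchedCount c (m t) : ℝ) / N - y ((t : ℝ) / N)| ≤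
              3 * S.L Q c * Real.exp (α * S.L Q c) / (N : ℝ) ^ (1 / 3 : ℝ)}).toReal ∧
      ∃ e : ℝ → ℝ, e 0 = 0 ∧
        ∀ s ∈ Set.Icc 0 α,
          y s = S.b c - S.b c * Real.exp (-S.L Q c * s) - e s ∧
          0 ≤ e s ∧ e s ≤ S.J Q c / S.L Q c * (1 - Real.exp (-S.L Q c * s)) := by
  obtain ⟨y, hy⟩ := hQ.1.exists_solution S hα.le c
  refine ⟨y, hy, fun z hz => hQ.1.solution_unique S hy hz, hQ.1.concentration S hN hα hT hy,
    fun s => S.b c - S.b c * Real.exp (-S.L Q c * s) - y s, by simp [hy.1], fun s hs => ⟨by ring,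
      sub_nonneg.2 (hQ.1.solution_le S hy s hs), hQ.1.solution_error_le S hy s hs⟩⟩
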